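/- Let $W(s) = 2^s \pi^{s-1} \sin\left(\frac{\pi s}{2}\right)\Gamma(1-s)$ be the meromorphic function on $\mathbb{C}$ appearing in the functional equation $\zeta(s) = W(s)\,\zeta(1-s)$ of the Riemann zeta function. Let $\sigma, t$ be real numbers with $0 \le \sigma \le 1$, $\sigma \ne \frac12$, and $|W(\sigma + it)| = 1$. Then $$2\pi < |t| < 2.01\,\pi .$$ -/

import Mathlib

/-- The meromorphic factor `W` of the functional equation `ζ(s) = W(s) ζ(1 - s)`, namely
`W(s) = 2^s π^(s-1) sin(π s / 2) Γ(1 - s)`.  In the strip `0 ≤ Re s ≤ 1` its only pole is `s = 1`,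
where the formula below takes the conventional value `0` (in particular not of modulus one). -/
noncomputable def W (s : ℂ) : ℂ :=
  (2 : ℂ) ^ s * (Real.pi : ℂ) ^ (s - 1) * Complex.sin (Real.pi * s / 2) * Complex.Gamma (1 - s)

open Filter Topology Finset

/-! Write f(y, σ) = log |W(σ + 2iy)|, where W(s) = π^(s-1/2) Γ((1-s)/2) / Γ(s/2). It is odd under σ
↦ 1 - σ, so a zero with σ ≠ 1/2 gives one with 0 ≤ σ < 1/2. There f is nondecreasing in |y|
(`logNormW_mono`), so it suffices that f < 0 at y = π (`logNormW_pi_neg`) and f > 0 at y = 1.005π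
(`logNormW_pos`).

Both signs come from convexity in σ on [0, 1/2], with f(y, 1/2) = 0. At y = π the chord from 0 to
1/2 lies below zero, since |W(2πi)|² = tanh(π²) < 1 by the reflection formula. At y = 1.005π the
tangent at 1/2 has negative slope, so it is positive to the left.

Convexity, monotonicity and the slope estimate are proved for Euler's finite products, where they
concern explicit finite sums, and only inequalities between values pass to the limit. Convexity
reduces to a sign for the third derivative of the partial sums, obtained by telescoping. -/

/-- The partial sum of `log |x + j + i y|`, the `x`-dependent part of Euler's finite approximation
to `-log |Γ(x + i y)|`. -/
noncomputable def logNormSum (y : ℝ) (n : ℕ) (x : ℝ) : ℝ :=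
  ∑ j ∈ range (n + 1), Real.log ((x + j) ^ 2 + y ^ 2) / 2

/-- The first derivative of `logNormSum`. -/
noncomputable def logNormSumDeriv (y : ℝ) (n : ℕ) (x : ℝ) : ℝ :=
  ∑ j ∈ range (n + 1), (x + j) / ((x + j) ^ 2 + y ^ 2)

/-- The second derivative of `logNormSum`. -/
noncomputable def logNormSumDerivTwo (y : ℝ) (n : ℕ) (x : ℝ) : ℝ :=
  ∑ j ∈ range (n + 1), (y ^ 2 - (x + j) ^ 2) / ((x + j) ^ 2 + y ^ 2) ^ 2

/-- The third derivative of `logNormSum`. -/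
noncomputable def logNormSumDerivThree (y : ℝ) (n : ℕ) (x : ℝ) : ℝ :=
  ∑ j ∈ range (n + 1), 2 * (x + j) * ((x + j) ^ 2 - 3 * y ^ 2) / ((x + j) ^ 2 + y ^ 2) ^ 3

section Derivatives

variable {y : ℝ}

lemma hasDerivAt_add_sq (x c y : ℝ) :
    HasDerivAt (fun x : ℝ => (x + c) ^ 2 + y ^ 2) (2 * (x + c)) x := by
  simpa using (((hasDerivAt_id x).add_const c).pow 2).add_const (y ^ 2)

lemma sq_add_sq_pos (hy : y ≠ 0) (u : ℝ) : 0 < u ^ 2 + y ^ 2 := by positivity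

lemma hasDerivAt_logNormSum (hy : y ≠ 0) (n : ℕ) (x : ℝ) :
    HasDerivAt (logNormSum y n) (logNormSumDeriv y n x) x := by
  unfold logNormSum logNormSumDeriv
  refine HasDerivAt.fun_sum fun j _ => ?_
  have h := (sq_add_sq_pos hy (x + j)).ne'
  exact (((hasDerivAt_add_sq x j y).log h).div_const 2).congr_deriv (by field_simp)

lemma hasDerivAt_logNormSumDeriv (hy : y ≠ 0) (n : ℕ) (x : ℝ) :
    HasDerivAt (logNormSumDeriv y n) (logNormSumDerivTwo y n x) x := by
  unfold logNormSumDeriv logNormSumDerivTwo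
  refine HasDerivAt.fun_sum fun j _ => ?_
  have h := (sq_add_sq_pos hy (x + j)).ne'
  refine (((hasDerivAt_id x).add_const (j : ℝ)).div (hasDerivAt_add_sq x j y) h).congr_deriv ?_
  simp only [id]
  ring

lemma hasDerivAt_logNormSumDerivTwo (hy : y ≠ 0) (n : ℕ) (x : ℝ) :
    HasDerivAt (logNormSumDerivTwo y n) (logNormSumDerivThree y n x) x := by
  unfold logNormSumDerivTwo logNormSumDerivThree
  refine HasDerivAt.fun_sum fun j _ => ?_
  have h := (sq_add_sq_pos hy (x + j)).ne'
  have h₁ : HasDerivAt (fun x : ℝ => y ^ 2 - (x + j) ^ 2) (-(2 * (x + j))) x := by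
    simpa using (((hasDerivAt_id x).add_const (j : ℝ)).pow 2).const_sub (y ^ 2)
  refine (h₁.div ((hasDerivAt_add_sq x j y).pow 2) (pow_ne_zero 2 h)).congr_deriv ?_
  simp only [Pi.pow_apply]
  field_simp
  ring

end Derivatives

/-! ### The third derivative is negative -/

/-- A function whose backward differences dominate `2 u (u² - 3 y²) / (u² + y²)³`. -/
noncomputable def cubicMajorant (y u : ℝ) : ℝ :=
  (((u : ℂ) + y * Complex.I) ^ 2 - ((u : ℂ) + y * Complex.I) + 1 / 2)⁻¹.re + 1 / 300 / (u + 1)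

lemma cubicMajorant_eq (y u : ℝ) :
    cubicMajorant y u = (u ^ 2 - u - y ^ 2 + 1 / 2) /
      ((u ^ 2 - u - y ^ 2 + 1 / 2) ^ 2 + ((2 * u - 1) * y) ^ 2) + 1 / 300 / (u + 1) := by
  have h : ((u : ℂ) + y * Complex.I) ^ 2 - ((u : ℂ) + y * Complex.I) + 1 / 2 =
      ((u ^ 2 - u - y ^ 2 + 1 / 2 : ℝ) : ℂ) + ((2 * u - 1) * y : ℝ) * Complex.I := by
    push_cast
    linear_combination (y : ℂ) ^ 2 * Complex.I_sq
  rw [cubicMajorant, h, Complex.inv_re, Complex.normSq_add_mul_I, Complex.add_re,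
    Complex.re_ofReal_mul, Complex.ofReal_re, Complex.I_re, mul_zero, add_zero]

lemma inv_cube_re (y u : ℝ) :
    (2 / ((u : ℂ) + y * Complex.I) ^ 3).re =
      2 * u * (u ^ 2 - 3 * y ^ 2) / (u ^ 2 + y ^ 2) ^ 3 := by
  have h : ((u : ℂ) + y * Complex.I) ^ 3 =
      ((u ^ 3 - 3 * u * y ^ 2 : ℝ) : ℂ) + (3 * u ^ 2 * y - y ^ 3 : ℝ) * Complex.I := by
    push_cast
    linear_combination (3 * u * (y : ℂ) ^ 2 + y ^ 3 * Complex.I) * Complex.I_sq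
  rw [h, div_eq_mul_inv, ← Complex.ofReal_ofNat, Complex.re_ofReal_mul, Complex.inv_re,
    Complex.normSq_add_mul_I, Complex.add_re, Complex.re_ofReal_mul, Complex.ofReal_re,
    Complex.I_re, mul_zero, add_zero]
  have h2 : (u ^ 3 - 3 * u * y ^ 2) ^ 2 + (3 * u ^ 2 * y - y ^ 3) ^ 2 = (u ^ 2 + y ^ 2) ^ 3 := by
    ring
  rw [h2]
  ring

lemma le_norm_pow_four_add {z : ℂ} (hz : 3.14 ≤ ‖z‖) : 96 ≤ ‖z ^ 4 + 1 / 4‖ := by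
  have h4 : 97 ≤ ‖z‖ ^ 4 := by
    calc (97 : ℝ) ≤ 3.14 ^ 4 := by norm_num
      _ ≤ ‖z‖ ^ 4 := by gcongr
  have h := norm_sub_le (z ^ 4 + 1 / 4) (1 / 4)
  rw [add_sub_cancel_right, norm_pow, show ‖(1 / 4 : ℂ)‖ = 1 / 4 by norm_num] at h
  linarith

lemma pow_four_add_ne_zero {z : ℂ} (hz : 3.14 ≤ ‖z‖) : z ^ 4 + 1 / 4 ≠ 0 := by
  rw [← norm_pos_iff]
  linarith [le_norm_pow_four_add hz]

lemma norm_inv_cube_sub_le {z : ℂ} (hz : 3.14 ≤ ‖z‖) :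
    ‖2 / z ^ 3 - 2 * z / (z ^ 4 + 1 / 4)‖ ≤ 1 / (600 * ‖z‖ ^ 2) := by
  have hz0 : z ≠ 0 := by
    rintro rfl
    norm_num at hz
  have hne := pow_four_add_ne_zero hz
  have hlow := le_norm_pow_four_add hz
  have heq : 2 / z ^ 3 - 2 * z / (z ^ 4 + 1 / 4) = 1 / (2 * (z ^ 3 * (z ^ 4 + 1 / 4))) := by
    rw [div_sub_div _ _ (pow_ne_zero 3 hz0) hne, div_eq_div_iff
      (mul_ne_zero (pow_ne_zero 3 hz0) hne)
      (mul_ne_zero two_ne_zero (mul_ne_zero (pow_ne_zero 3 hz0) hne))]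
    ring
  rw [heq, norm_div, norm_one, norm_mul, norm_mul, norm_pow, Complex.norm_two]
  set r := ‖z‖
  have hr : 0 < r := by linarith
  apply one_div_le_one_div_of_le (by positivity)
  calc 600 * r ^ 2 ≤ 2 * ((3.14 * r ^ 2) * 96) := by nlinarith [sq_nonneg r]
    _ ≤ 2 * (r ^ 3 * ‖z ^ 4 + 1 / 4‖) := by
      gcongr
      nlinarith [sq_nonneg r]

/-- With z = u + iy, the factorization of z⁴ + 1/4 into z² - z + 1/2 and its shift by 1 makes 2z/(z⁴
+ 1/4), a close approximation to 2/z³, an exact difference. The term 1/300/(u + 1) telescopes too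
and absorbs the error. -/
lemma le_cubicMajorant_sub {y u : ℝ} (hy : 3.14 ≤ y) (hu : 0 ≤ u) :
    2 * u * (u ^ 2 - 3 * y ^ 2) / (u ^ 2 + y ^ 2) ^ 3 ≤
      cubicMajorant y u - cubicMajorant y (u + 1) := by
  set z : ℂ := (u : ℂ) + y * Complex.I with hz
  have hr2 : ‖z‖ ^ 2 = u ^ 2 + y ^ 2 := by
    rw [hz, Complex.norm_add_mul_I, Real.sq_sqrt (by positivity)]
  have hr : 3.14 ≤ ‖z‖ := by
    refine le_of_sq_le_sq ?_ (norm_nonneg z)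
    rw [hr2]
    nlinarith
  have hF : (z ^ 2 - z + 1 / 2)⁻¹ - ((z + 1) ^ 2 - (z + 1) + 1 / 2)⁻¹ =
      2 * z / (z ^ 4 + 1 / 4) := by
    have hfac : (z ^ 2 - z + 1 / 2) * ((z + 1) ^ 2 - (z + 1) + 1 / 2) = z ^ 4 + 1 / 4 := by ring
    have hne := pow_four_add_ne_zero hr
    rw [← hfac] at hne ⊢
    rw [inv_sub_inv (left_ne_zero_of_mul hne) (right_ne_zero_of_mul hne)]
    ring
  have hre := (Complex.re_le_norm (2 / z ^ 3 - 2 * z / (z ^ 4 + 1 / 4))).trans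
    (norm_inv_cube_sub_le hr)
  rw [Complex.sub_re, ← hF, inv_cube_re, Complex.sub_re, hr2] at hre
  have hz1 : (((u + 1 : ℝ) : ℂ) + y * Complex.I) = z + 1 := by
    rw [hz]; push_cast; ring
  rw [cubicMajorant, cubicMajorant, hz1, ← hz]
  -- Equivalent to (u + 1)(u + 2) ≤ 2(u² + y²), that is, (u - 3/2)² + 2y² ≥ 17/4.
  have htel : 1 / (600 * (u ^ 2 + y ^ 2)) ≤ 1 / 300 / (u + 1) - 1 / 300 / (u + 1 + 1) := by
    rw [div_sub_div _ _ (by positivity) (by positivity), div_le_div_iff₀ (by positivity)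
      (by positivity)]
    nlinarith [sq_nonneg (u - 3 / 2)]
  linarith

lemma cubicMajorant_nonpos {y x : ℝ} (hy : 3.14 ≤ y) (hy' : y ≤ 3.2) (hx : 0 ≤ x)
    (hx' : x ≤ 1 / 2) : cubicMajorant y x ≤ 0 := by
  rw [cubicMajorant_eq]
  have hA : x ^ 2 - x - y ^ 2 + 1 / 2 ≤ -9.3 := by nlinarith
  have hA' : -11 ≤ x ^ 2 - x - y ^ 2 + 1 / 2 := by nlinarith
  have hB : ((2 * x - 1) * y) ^ 2 ≤ 11 := by
    rw [mul_pow]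
    have h1 : (2 * x - 1) ^ 2 ≤ 1 := by nlinarith
    have h2 : y ^ 2 ≤ 11 := by nlinarith
    nlinarith [sq_nonneg y]
  set A := x ^ 2 - x - y ^ 2 + 1 / 2
  have h1 : A / (A ^ 2 + ((2 * x - 1) * y) ^ 2) ≤ -(1 / 300) := by
    have hpos : 0 < A ^ 2 + ((2 * x - 1) * y) ^ 2 := by nlinarith [sq_nonneg ((2 * x - 1) * y)]
    rw [div_le_iff₀ hpos]
    nlinarith
  have h2 : 1 / 300 / (x + 1) ≤ 1 / 300 := by
    rw [div_le_iff₀ (by positivity)]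
    linarith
  linarith

lemma cubicMajorant_nonneg {y u : ℝ} (hy : 0 ≤ y) (hy' : y ≤ 3.2) (hu : 4 ≤ u) :
    0 ≤ cubicMajorant y u := by
  rw [cubicMajorant_eq]
  have : 0 ≤ u ^ 2 - u - y ^ 2 + 1 / 2 := by nlinarith
  positivity

/-- The individual terms change sign, but the telescoped bound leaves only the majorant at x
(nonpositive) minus the majorant at x + n + 1 (nonnegative once u² - u exceeds y²). The window
[3.14, 3.2] contains π and 1.005π. -/
lemma logNormSumDerivThree_nonpos {y x : ℝ} {n : ℕ} (hy : 3.14 ≤ y) (hy' : y ≤ 3.2)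
    (hn : 4 ≤ n) (hx : 0 ≤ x) (hx' : x ≤ 1 / 2) : logNormSumDerivThree y n x ≤ 0 := by
  have h : logNormSumDerivThree y n x ≤
      ∑ j ∈ range (n + 1), (cubicMajorant y (x + j) - cubicMajorant y (x + (j + 1 : ℕ))) := by
    refine sum_le_sum fun j _ => ?_
    have := le_cubicMajorant_sub hy (u := x + j) (by positivity)
    rwa [add_assoc, ← Nat.cast_succ] at this
  rw [sum_range_sub' (fun j : ℕ => cubicMajorant y (x + j))] at h
  have h0 := cubicMajorant_nonpos hy hy' hx hx'
  have hn' : (4 : ℝ) ≤ n := by exact_mod_cast hn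
  have h1 := cubicMajorant_nonneg (y := y) (u := x + (n + 1 : ℕ)) (by linarith) hy' (by
    push_cast; linarith)
  simp only [Nat.cast_zero, add_zero] at h
  linarith

lemma logNormSumDerivTwo_antitoneOn {y : ℝ} {n : ℕ} (hy : 3.14 ≤ y) (hy' : y ≤ 3.2)
    (hn : 4 ≤ n) : AntitoneOn (logNormSumDerivTwo y n) (Set.Icc 0 (1 / 2)) := by
  have hd := hasDerivAt_logNormSumDerivTwo (y := y) (by linarith) n
  refine antitoneOn_of_hasDerivWithinAt_nonpos (convex_Icc _ _)
    (fun x _ => (hd x).continuousAt.continuousWithinAt) (fun x _ => (hd x).hasDerivWithinAt) ?_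
  intro x hx
  rw [interior_Icc] at hx
  exact logNormSumDerivThree_nonpos hy hy' hn hx.1.le hx.2.le

/-! ### Finite approximations to `log |W|` -/

/-- Euler's finite approximation to `log |Γ(x + i y)|`. -/
noncomputable def logGammaApprox (y : ℝ) (n : ℕ) (x : ℝ) : ℝ :=
  x * Real.log n + Real.log n.factorial - logNormSum y n x

/-- The finite approximation to `log |W(σ + 2 i y)|`. -/
noncomputable def logWApprox (y : ℝ) (n : ℕ) (σ : ℝ) : ℝ :=
  (σ - 1 / 2) * Real.log Real.pi + logGammaApprox y n ((1 - σ) / 2) - logGammaApprox y n (σ / 2)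

lemma logWApprox_half (y : ℝ) (n : ℕ) : logWApprox y n (1 / 2) = 0 := by
  norm_num [logWApprox]

lemma hasDerivAt_logWApprox {y : ℝ} (hy : y ≠ 0) (n : ℕ) (σ : ℝ) :
    HasDerivAt (logWApprox y n) (Real.log Real.pi - Real.log n +
      (logNormSumDeriv y n ((1 - σ) / 2) + logNormSumDeriv y n (σ / 2)) / 2) σ := by
  have h1 : HasDerivAt (fun σ : ℝ => (1 - σ) / 2) (-1 / 2) σ :=
    ((hasDerivAt_id σ).const_sub 1).div_const 2
  have h2 : HasDerivAt (fun σ : ℝ => σ / 2) (1 / 2) σ := (hasDerivAt_id σ).div_const 2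
  have h3 := (hasDerivAt_logNormSum hy n ((1 - σ) / 2)).comp σ h1
  have h4 := (hasDerivAt_logNormSum hy n (σ / 2)).comp σ h2
  have h5 := ((((hasDerivAt_id σ).sub_const (1 / 2)).mul_const (Real.log Real.pi)).add
    (((h1.mul_const (Real.log n)).add_const (Real.log n.factorial)).sub h3)).sub
    (((h2.mul_const (Real.log n)).add_const (Real.log n.factorial)).sub h4)
  exact h5.congr_deriv (by ring)

lemma convexOn_logWApprox {y : ℝ} {n : ℕ} (hy : 3.14 ≤ y) (hy' : y ≤ 3.2) (hn : 4 ≤ n) :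
    ConvexOn ℝ (Set.Icc 0 (1 / 2)) (logWApprox y n) := by
  have hy0 : y ≠ 0 := by linarith
  have hd := hasDerivAt_logWApprox hy0 n
  refine convexOn_of_hasDerivWithinAt2_nonneg (convex_Icc _ _)
    (fun x _ => (hd x).continuousAt.continuousWithinAt) (fun x _ => (hd x).hasDerivWithinAt)
    (f'' := fun σ => (logNormSumDerivTwo y n (σ / 2) - logNormSumDerivTwo y n ((1 - σ) / 2)) / 4)
    (fun σ _ => ?_) (fun σ hσ => ?_)
  · have h1 : HasDerivAt (fun σ : ℝ => (1 - σ) / 2) (-1 / 2) σ :=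
      ((hasDerivAt_id σ).const_sub 1).div_const 2
    have h2 : HasDerivAt (fun σ : ℝ => σ / 2) (1 / 2) σ := (hasDerivAt_id σ).div_const 2
    have h3 := (hasDerivAt_logNormSumDeriv hy0 n ((1 - σ) / 2)).comp σ h1
    have h4 := (hasDerivAt_logNormSumDeriv hy0 n (σ / 2)).comp σ h2
    exact (((h3.add h4).div_const 2).const_add (Real.log Real.pi - Real.log n)).hasDerivWithinAt
      |>.congr_deriv (by ring)
  · rw [interior_Icc] at hσ
    obtain ⟨h0, h1⟩ := hσ
    -- For σ ≤ 1/2 the two arguments satisfy σ/2 ≤ (1 - σ)/2, both in [0, 1/2].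
    have := logNormSumDerivTwo_antitoneOn hy hy' hn (a := σ / 2) (b := (1 - σ) / 2)
      ⟨by linarith, by linarith⟩ ⟨by linarith, by linarith⟩ (by linarith)
    linarith

lemma logWApprox_mono {y₁ y₂ σ : ℝ} (h : y₁ ^ 2 ≤ y₂ ^ 2) (hσ : 0 ≤ σ) (hσ' : σ ≤ 1 / 2)
    (h0 : 0 < (σ / 2) ^ 2 + y₁ ^ 2) (n : ℕ) : logWApprox y₁ n σ ≤ logWApprox y₂ n σ := by
  have key : ∀ j : ℕ, Real.log ((σ / 2 + j) ^ 2 + y₁ ^ 2) + Real.log (((1 - σ) / 2 + j) ^ 2 + y₂ ^ 2)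
      ≤ Real.log ((σ / 2 + j) ^ 2 + y₂ ^ 2) + Real.log (((1 - σ) / 2 + j) ^ 2 + y₁ ^ 2) := by
    intro j
    have hj : (0 : ℝ) ≤ j := j.cast_nonneg
    have ha : 0 < (σ / 2 + j) ^ 2 + y₁ ^ 2 := by nlinarith
    have hab : (σ / 2 + j) ^ 2 ≤ ((1 - σ) / 2 + j) ^ 2 := by
      apply pow_le_pow_left₀ (by positivity)
      linarith
    rw [← Real.log_mul (by linarith) (by linarith), ← Real.log_mul (by linarith) (by linarith)]
    apply Real.log_le_log (mul_pos (by linarith) (by linarith))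
    -- With a = σ/2 + j and b = (1 - σ)/2 + j, the difference of the two products is (b² - a²)(y₂² -
    -- y₁²).
    nlinarith
  have hs := sum_le_sum fun j (_ : j ∈ range (n + 1)) => key j
  rw [sum_add_distrib, sum_add_distrib] at hs
  unfold logWApprox logGammaApprox logNormSum
  simp only [← sum_div]
  linarith

/-! ### The limit of the finite approximations -/

/-- The value of `log |W(σ + 2 i y)|`, expressed through `W(s) = π^(s-1/2) Γ((1-s)/2) / Γ(s/2)`. -/
noncomputable def logNormW (y σ : ℝ) : ℝ :=
  (σ - 1 / 2) * Real.log Real.pi + Real.log ‖Complex.Gamma (((1 - σ) / 2 : ℝ) + y * Complex.I)‖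
    - Real.log ‖Complex.Gamma ((σ / 2 : ℝ) + y * Complex.I)‖

lemma add_natCast_ne_zero {x y : ℝ} (hx : 0 ≤ x) (h : x ≠ 0 ∨ y ≠ 0) (j : ℕ) :
    (x : ℂ) + y * Complex.I + j ≠ 0 := by
  intro h0
  have hre := congrArg Complex.re h0
  have him := congrArg Complex.im h0
  simp at hre him
  have hj : (0 : ℝ) ≤ j := j.cast_nonneg
  rcases h with h | h
  · exact h (by linarith)
  · exact h him

lemma log_norm_GammaSeq {x y : ℝ} (hx : 0 ≤ x) (h : x ≠ 0 ∨ y ≠ 0) {n : ℕ} (hn : n ≠ 0) :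
    Real.log ‖Complex.GammaSeq (x + y * Complex.I) n‖ = logGammaApprox y n x := by
  have hn0 : (0 : ℝ) < n := by positivity
  have hne : ∀ j ∈ range (n + 1), ‖(x : ℂ) + y * Complex.I + j‖ ≠ 0 :=
    fun j _ => norm_ne_zero_iff.2 (add_natCast_ne_zero hx h j)
  have hpow : ‖(n : ℂ) ^ ((x : ℂ) + y * Complex.I)‖ = (n : ℝ) ^ x := by
    rw [← Complex.ofReal_natCast, Complex.norm_cpow_eq_rpow_re_of_pos hn0]
    simp
  rw [Complex.GammaSeq, norm_div, norm_mul, norm_prod, hpow, Complex.norm_natCast,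
    Real.log_div (by positivity) (prod_ne_zero_iff.2 hne), Real.log_mul (by positivity)
    (by positivity), Real.log_rpow hn0, Real.log_prod hne, logGammaApprox, logNormSum]
  congr 1
  refine sum_congr rfl fun j _ => ?_
  rw [show (x : ℂ) + y * Complex.I + j = ((x + j : ℝ) : ℂ) + y * Complex.I by push_cast; ring,
    Complex.norm_add_mul_I, Real.log_sqrt (by positivity)]

lemma tendsto_logGammaApprox {x y : ℝ} (hx : 0 ≤ x) (h : x ≠ 0 ∨ y ≠ 0) :
    Tendsto (fun n => logGammaApprox y n x) atTop
      (𝓝 (Real.log ‖Complex.Gamma (x + y * Complex.I)‖)) := by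
  have hne : Complex.Gamma (x + y * Complex.I) ≠ 0 := by
    refine Complex.Gamma_ne_zero fun m hm => add_natCast_ne_zero hx h m ?_
    rw [hm, neg_add_cancel]
  have := (Complex.GammaSeq_tendsto_Gamma (x + y * Complex.I)).norm.log (norm_ne_zero_iff.2 hne)
  refine this.congr' ?_
  filter_upwards [eventually_ne_atTop 0] with n hn using log_norm_GammaSeq hx h hn

lemma tendsto_logWApprox {σ y : ℝ} (hσ : 0 ≤ σ) (hσ' : σ ≤ 1 / 2) (h : σ ≠ 0 ∨ y ≠ 0) :
    Tendsto (fun n => logWApprox y n σ) atTop (𝓝 (logNormW y σ)) := by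
  have h1 := tendsto_logGammaApprox (x := (1 - σ) / 2) (y := y) (by linarith)
    (Or.inl (by linarith))
  have h2 := tendsto_logGammaApprox (x := σ / 2) (y := y) (by linarith)
    (h.imp_left fun h => by positivity)
  exact (h1.const_add _).sub h2

lemma logNormW_mono {y₁ y₂ σ : ℝ} (h : y₁ ^ 2 ≤ y₂ ^ 2) (hσ : 0 ≤ σ) (hσ' : σ ≤ 1 / 2)
    (h0 : σ ≠ 0 ∨ y₁ ≠ 0) : logNormW y₁ σ ≤ logNormW y₂ σ := by
  have hpos : 0 < (σ / 2) ^ 2 + y₁ ^ 2 := by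
    rcases h0 with h0 | h0 <;> positivity
  refine le_of_tendsto_of_tendsto' (tendsto_logWApprox hσ hσ' h0)
    (tendsto_logWApprox hσ hσ' (h0.imp_right fun h1 h2 => h1 ?_))
    (fun n => logWApprox_mono h hσ hσ' hpos n)
  rw [h2] at h
  exact pow_eq_zero_iff two_ne_zero |>.1 (le_antisymm (by simpa using h) (sq_nonneg y₁))

lemma logNormW_one_sub (y σ : ℝ) : logNormW y (1 - σ) = -logNormW y σ := by
  rw [logNormW, logNormW, sub_sub_cancel]
  ring

/-! ### Negativity at height `2π` -/

/-- On Re z = 1/2 one has 1 - z = conj z, so the reflection formula gives the squared modulus. -/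
lemma norm_sq_Gamma_half_add (y : ℝ) :
    ‖Complex.Gamma ((1 / 2 : ℝ) + y * Complex.I)‖ ^ 2 = Real.pi / Real.cosh (Real.pi * y) := by
  have h := Complex.Gamma_mul_Gamma_one_sub ((1 / 2 : ℝ) + y * Complex.I)
  have hc : 1 - (((1 / 2 : ℝ) : ℂ) + y * Complex.I) =
      (starRingEnd ℂ) (((1 / 2 : ℝ) : ℂ) + y * Complex.I) := by
    simp only [map_add, map_mul, Complex.conj_ofReal, Complex.conj_I]
    push_cast
    ring
  have hs : Complex.sin (Real.pi * (((1 / 2 : ℝ) : ℂ) + y * Complex.I)) =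
      (Real.cosh (Real.pi * y) : ℝ) := by
    rw [show (Real.pi : ℂ) * (((1 / 2 : ℝ) : ℂ) + y * Complex.I) =
      (Real.pi * y : ℝ) * Complex.I + Real.pi / 2 by push_cast; ring, Complex.sin_add_pi_div_two,
      Complex.cos_mul_I, Complex.ofReal_cosh]
  rw [hc, Complex.Gamma_conj, Complex.mul_conj, hs, ← Complex.ofReal_div,
    Complex.normSq_eq_norm_sq] at h
  exact_mod_cast h

lemma norm_sq_Gamma_mul_I {y : ℝ} (hy : 0 < y) :
    ‖Complex.Gamma (y * Complex.I)‖ ^ 2 = Real.pi / (y * Real.sinh (Real.pi * y)) := by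
  have hz : (-(y * Complex.I) : ℂ) ≠ 0 := by simp [hy.ne']
  have h := Complex.Gamma_mul_Gamma_one_sub (y * Complex.I)
  have hc : Complex.Gamma (1 - y * Complex.I) =
      -(y * Complex.I) * (starRingEnd ℂ) (Complex.Gamma (y * Complex.I)) := by
    rw [show (1 - y * Complex.I : ℂ) = -(y * Complex.I) + 1 by ring, Complex.Gamma_add_one _ hz,
      ← Complex.Gamma_conj]
    simp
  rw [hc, mul_left_comm, Complex.mul_conj, ← mul_assoc, Complex.sin_mul_I,
    Complex.normSq_eq_norm_sq, ← Complex.ofReal_mul, ← Complex.ofReal_sinh] at h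
  have h2 := congrArg norm h
  simp only [norm_mul, norm_neg, norm_div, Complex.norm_I, mul_one, Complex.norm_real,
    Real.norm_eq_abs, abs_sq, abs_of_pos hy, abs_of_pos Real.pi_pos,
    abs_of_pos (Real.sinh_pos_iff.2 (mul_pos Real.pi_pos hy))] at h2
  rw [← div_div, div_right_comm, ← h2]
  field_simp

lemma logNormW_pi_zero_neg : logNormW Real.pi 0 < 0 := by
  have hpi := Real.pi_pos
  have hs : 0 < Real.sinh (Real.pi * Real.pi) := Real.sinh_pos_iff.2 (by positivity)
  have hc := Real.cosh_pos (Real.pi * Real.pi)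
  have h1 := congrArg Real.log (norm_sq_Gamma_half_add Real.pi)
  have h2 := congrArg Real.log (norm_sq_Gamma_mul_I hpi)
  rw [Real.log_pow, Real.log_div hpi.ne' (by positivity)] at h1 h2
  rw [Real.log_mul hpi.ne' hs.ne'] at h2
  have h3 := Real.log_lt_log hs (Real.sinh_lt_cosh (Real.pi * Real.pi))
  simp only [logNormW, sub_zero, zero_div, Complex.ofReal_zero, zero_add]
  push_cast at h1 h2 ⊢
  linarith

lemma logNormW_pi_neg {σ : ℝ} (hσ : 0 ≤ σ) (hσ' : σ < 1 / 2) : logNormW Real.pi σ < 0 := by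
  have hpi := Real.pi_pos
  -- Chord bound for σ = (1 - 2σ)·0 + 2σ·(1/2); strictness comes only afterwards, from the value at
  -- 0.
  have key : logNormW Real.pi σ ≤ (1 - 2 * σ) * logNormW Real.pi 0 := by
    refine le_of_tendsto_of_tendsto (tendsto_logWApprox hσ hσ'.le (Or.inr hpi.ne'))
      ((tendsto_logWApprox le_rfl (by norm_num) (Or.inr hpi.ne')).const_mul _) ?_
    filter_upwards [eventually_ge_atTop 4] with n hn
    have hconv := convexOn_logWApprox (y := Real.pi) Real.pi_gt_d2.le
      (by linarith [Real.pi_lt_d2]) hn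
    have h := hconv.2 (Set.left_mem_Icc.2 (by norm_num)) (Set.right_mem_Icc.2 (by norm_num))
      (show 0 ≤ 1 - 2 * σ by linarith) (show 0 ≤ 2 * σ by linarith) (by ring)
    simp only [smul_eq_mul, logWApprox_half, mul_zero, zero_add, add_zero] at h
    rwa [show 2 * σ * (1 / 2) = σ by ring] at h
  exact key.trans_lt (mul_neg_of_pos_of_neg (by linarith) logNormW_pi_zero_neg)

/-! ### Positivity at height `2.01π` -/

/-- This is v + v³/3 ≤ artanh v for v = u/(u² + y²). The shift -1/4 makes the two logarithms those
of u² + y² ± u, so their ratio is exactly (1 + v)/(1 - v), and the right side telescopes under u ↦ u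
+ 1. -/
lemma div_add_cube_le_log {u y : ℝ} (hu : 0 ≤ u) (hy : 1 / 2 < y) :
    u / (u ^ 2 + y ^ 2) + (u / (u ^ 2 + y ^ 2)) ^ 3 / 3 ≤
      Real.log ((u + 1 / 2) ^ 2 + y ^ 2 - 1 / 4) / 2 -
        Real.log ((u - 1 / 2) ^ 2 + y ^ 2 - 1 / 4) / 2 := by
  have hA : 0 < u ^ 2 + y ^ 2 := by positivity
  have hm : 0 < u ^ 2 + y ^ 2 - u := by nlinarith [sq_nonneg (u - 1 / 2)]
  have hx1 : u / (u ^ 2 + y ^ 2) < 1 := by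
    rw [div_lt_one hA]
    linarith
  have h := Real.sum_range_le_log_div (x := u / (u ^ 2 + y ^ 2)) (by positivity) hx1 2
  have hq : (1 + u / (u ^ 2 + y ^ 2)) / (1 - u / (u ^ 2 + y ^ 2)) =
      ((u + 1 / 2) ^ 2 + y ^ 2 - 1 / 4) / ((u - 1 / 2) ^ 2 + y ^ 2 - 1 / 4) := by
    rw [one_add_div hA.ne', one_sub_div hA.ne', div_div_div_cancel_right₀ hA.ne']
    congr 1 <;> ring
  rw [hq, Real.log_div (by nlinarith) (by nlinarith)] at h
  norm_num [sum_range_succ] at h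
  norm_num
  linarith

lemma logNormSumDeriv_quarter_le {y : ℝ} (hy : 1 / 2 < y) {n : ℕ} (hn : 7 ≤ n) :
    logNormSumDeriv y n (1 / 4) ≤ Real.log ((n + 3 / 4) ^ 2 + y ^ 2 - 1 / 4) / 2 -
      Real.log (y ^ 2 - 3 / 16) / 2 -
      ∑ j ∈ range 8, (((1 / 4 : ℝ) + j) / ((1 / 4 + j) ^ 2 + y ^ 2)) ^ 3 / 3 := by
  set G : ℕ → ℝ := fun j => -(Real.log (((j : ℝ) - 1 / 4) ^ 2 + y ^ 2 - 1 / 4) / 2) with hG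
  have h : ∑ j ∈ range (n + 1), (((1 / 4 : ℝ) + j) / ((1 / 4 + j) ^ 2 + y ^ 2) +
      (((1 / 4 : ℝ) + j) / ((1 / 4 + j) ^ 2 + y ^ 2)) ^ 3 / 3) ≤
      ∑ j ∈ range (n + 1), (G j - G (j + 1)) := by
    refine sum_le_sum fun j _ => ?_
    have := div_add_cube_le_log (u := 1 / 4 + j) (by positivity) hy
    rw [show (1 / 4 + (j : ℝ) + 1 / 2) = ((j + 1 : ℕ) : ℝ) - 1 / 4 by push_cast; ring,
      show (1 / 4 + (j : ℝ) - 1 / 2) = (j : ℝ) - 1 / 4 by ring] at this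
    simp only [hG]
    linarith
  rw [sum_range_sub', sum_add_distrib] at h
  have hsub : ∑ j ∈ range 8, (((1 / 4 : ℝ) + j) / ((1 / 4 + j) ^ 2 + y ^ 2)) ^ 3 / 3 ≤
      ∑ j ∈ range (n + 1), (((1 / 4 : ℝ) + j) / ((1 / 4 + j) ^ 2 + y ^ 2)) ^ 3 / 3 :=
    sum_le_sum_of_subset_of_nonneg (range_subset_range.2 (by omega)) fun j _ _ => by positivity
  simp only [hG] at h
  rw [show ((n + 1 : ℕ) : ℝ) - 1 / 4 = n + 3 / 4 by push_cast; ring,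
    show ((0 : ℕ) - 1 / 4 : ℝ) ^ 2 + y ^ 2 - 1 / 4 = y ^ 2 - 3 / 16 by norm_num; ring] at h
  rw [logNormSumDeriv]
  linarith

/-- The cubic terms are indispensable: (1.005π)² - 3/16 is below π², so the logarithm alone loses up
to 0.0046, while eight cubic terms gain more than 0.0047. -/
lemma log_pi_lt :
    Real.log Real.pi < Real.log ((1.005 * Real.pi) ^ 2 - 3 / 16) / 2 +
      ∑ j ∈ range 8, (((1 / 4 : ℝ) + j) / ((1 / 4 + j) ^ 2 + (1.005 * Real.pi) ^ 2)) ^ 3 / 3 := by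
  have hpi := Real.pi_pos
  have hlo : 9.869 < Real.pi ^ 2 := by nlinarith [Real.pi_gt_d4]
  have hhi : (1.005 * Real.pi) ^ 2 < 9.97 := by nlinarith [Real.pi_lt_d4]
  have hsum : 0.0047 < ∑ j ∈ range 8,
      (((1 / 4 : ℝ) + j) / ((1 / 4 + j) ^ 2 + (1.005 * Real.pi) ^ 2)) ^ 3 / 3 := by
    calc (0.0047 : ℝ) < ∑ j ∈ range 8, (((1 / 4 : ℝ) + j) / ((1 / 4 + j) ^ 2 + 9.97)) ^ 3 / 3 := by
          norm_num [sum_range_succ]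
      _ ≤ _ := by
          refine sum_le_sum fun j _ => ?_
          gcongr
  have hlog : -0.0092 ≤ Real.log ((1.005 * Real.pi) ^ 2 - 3 / 16) - 2 * Real.log Real.pi := by
    have hp : 0 < (1.005 * Real.pi) ^ 2 - 3 / 16 := by nlinarith
    have h2 : 2 * Real.log Real.pi = Real.log (Real.pi ^ 2) := by simp
    rw [h2, ← Real.log_div hp.ne' (by positivity)]
    refine le_trans ?_ (Real.one_sub_inv_le_log_of_pos (by positivity))
    rw [inv_div, le_sub_comm, div_le_iff₀ hp]
    nlinarith
  linarith

lemma tendsto_log_shift (c d : ℝ) :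
    Tendsto (fun n : ℕ => Real.log ((n + c) ^ 2 + d) / 2 - Real.log n) atTop (𝓝 0) := by
  have h : Tendsto (fun n : ℕ => (1 + c * (n : ℝ)⁻¹) ^ 2 + d * ((n : ℝ)⁻¹) ^ 2) atTop (𝓝 1) := by
    have hi := tendsto_inv_atTop_nhds_zero_nat (𝕜 := ℝ)
    simpa using (((hi.const_mul c).const_add 1).pow 2).add ((hi.pow 2).const_mul d)
  have hl := (h.log one_ne_zero).div_const 2
  rw [Real.log_one, zero_div] at hl
  refine hl.congr' ?_
  filter_upwards [eventually_ne_atTop 0, h.eventually (lt_mem_nhds one_pos)] with n hn hpos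
  have hn0 : (n : ℝ) ≠ 0 := by exact_mod_cast hn
  have he : ((n : ℝ) + c) ^ 2 + d = n ^ 2 * ((1 + c * (n : ℝ)⁻¹) ^ 2 + d * ((n : ℝ)⁻¹) ^ 2) := by
    field_simp
  rw [he, Real.log_mul (by positivity) hpos.ne', Real.log_pow]
  push_cast
  ring

/-- At σ = 1/2 both arguments σ/2 and (1 - σ)/2 equal 1/4, so this bounds the slope there. The gap δ
is uniform in n so that strict positivity survives the limit. -/
lemma exists_deriv_logWApprox_half_le : ∃ δ > 0, ∀ᶠ n : ℕ in atTop,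
    Real.log Real.pi - Real.log n + logNormSumDeriv (1.005 * Real.pi) n (1 / 4) ≤ -δ := by
  set c := Real.log ((1.005 * Real.pi) ^ 2 - 3 / 16) / 2 +
      ∑ j ∈ range 8, (((1 / 4 : ℝ) + j) / ((1 / 4 + j) ^ 2 + (1.005 * Real.pi) ^ 2)) ^ 3 / 3
      - Real.log Real.pi with hc
  have hc0 : 0 < c := by
    have := log_pi_lt
    rw [hc]
    linarith
  refine ⟨c / 2, half_pos hc0, ?_⟩
  filter_upwards [eventually_ge_atTop 7, (tendsto_log_shift (3 / 4)
    ((1.005 * Real.pi) ^ 2 - 1 / 4)).eventually (gt_mem_nhds (half_pos hc0))] with n hn hlt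
  have h := logNormSumDeriv_quarter_le (y := 1.005 * Real.pi) (by linarith [Real.pi_gt_three]) hn
  rw [← add_sub_assoc] at hlt
  linarith

lemma logNormW_pos {σ : ℝ} (hσ : 0 ≤ σ) (hσ' : σ < 1 / 2) : 0 < logNormW (1.005 * Real.pi) σ := by
  obtain ⟨δ, hδ, hev⟩ := exists_deriv_logWApprox_half_le
  have hlo := Real.pi_gt_d2
  have hhi := Real.pi_lt_d2
  have hy0 : (1.005 * Real.pi) ≠ 0 := by positivity
  have key : δ * (1 / 2 - σ) ≤ logNormW (1.005 * Real.pi) σ := by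
    refine ge_of_tendsto (tendsto_logWApprox hσ hσ'.le (Or.inr hy0)) ?_
    filter_upwards [hev, eventually_ge_atTop 4] with n hn hn4
    -- By convexity the secant slope from σ to 1/2 is at most the derivative at 1/2, hence at most
    -- -δ.
    have h := (convexOn_logWApprox (y := 1.005 * Real.pi) (by linarith) (by linarith)
      hn4).slope_le_of_hasDerivAt (x := σ) (y := 1 / 2) ⟨hσ, hσ'.le⟩ (by norm_num) hσ'
      (hasDerivAt_logWApprox hy0 n (1 / 2))
    rw [slope_def_field, logWApprox_half, div_le_iff₀ (by linarith)] at h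
    norm_num at h hn ⊢
    nlinarith
  exact (mul_pos hδ (by linarith)).trans_le key

/-! ### The factor `W` -/

lemma W_eq_Gammaℝ_div {s : ℂ} (hs : ∀ n : ℕ, s ≠ n + 1) :
    W s = Complex.Gammaℝ (1 - s) / Complex.Gammaℝ s := by
  have hpi : (Real.pi : ℂ) ≠ 0 := by exact_mod_cast Real.pi_ne_zero
  have h := Complex.inv_Gammaℝ_one_sub (s := 1 - s) (fun n hn => hs n (by linear_combination -hn))
  have h0 : Complex.Gammaℝ (1 - s) ≠ 0 := by
    rw [Ne, Complex.Gammaℝ_eq_zero_iff]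
    rintro ⟨n, hn⟩
    refine hs (2 * n) ?_
    push_cast
    linear_combination -hn
  rw [sub_sub_cancel] at h
  rw [div_eq_mul_inv, h, mul_left_comm, mul_inv_cancel₀ h0, mul_one, Complex.Gammaℂ_def, W,
    show (Real.pi : ℂ) * (1 - s) / 2 = Real.pi / 2 - Real.pi * s / 2 by ring,
    Complex.cos_pi_div_two_sub, neg_sub, ← Complex.ofReal_ofNat, Complex.mul_cpow_ofReal_nonneg
    (by norm_num) Real.pi_pos.le, Complex.cpow_sub _ _ (by norm_num : ((2 : ℝ) : ℂ) ≠ 0),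
    Complex.cpow_one]
  push_cast
  ring

lemma log_norm_Gammaℝ {x y : ℝ} (hx : 0 ≤ x) (h : x ≠ 0 ∨ y ≠ 0) :
    Real.log ‖Complex.Gammaℝ (x + 2 * y * Complex.I)‖ = -(x / 2) * Real.log Real.pi +
      Real.log ‖Complex.Gamma ((x / 2 : ℝ) + y * Complex.I)‖ := by
  have harg : ((x : ℂ) + 2 * y * Complex.I) / 2 = (x / 2 : ℝ) + y * Complex.I := by
    push_cast
    ring
  have hne : Complex.Gamma ((x / 2 : ℝ) + y * Complex.I) ≠ 0 := by
    refine Complex.Gamma_ne_zero fun m hm => add_natCast_ne_zero (x := x / 2) (y := y)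
      (by positivity) (h.imp_left fun h => by positivity) m ?_
    rw [hm, neg_add_cancel]
  rw [Complex.Gammaℝ_def, neg_div, harg, norm_mul,
    Complex.norm_cpow_eq_rpow_re_of_pos Real.pi_pos, Real.log_mul (by positivity)
    (norm_ne_zero_iff.2 hne), Real.log_rpow Real.pi_pos]
  simp

lemma norm_Gamma_neg_im (x y : ℝ) :
    ‖Complex.Gamma (x + (-y : ℝ) * Complex.I)‖ = ‖Complex.Gamma (x + y * Complex.I)‖ := by
  rw [← Complex.norm_conj (Complex.Gamma (x + y * Complex.I)), ← Complex.Gamma_conj]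
  simp

lemma log_norm_W {σ t : ℝ} (hσ : 0 ≤ σ) (hσ' : σ ≤ 1) (h0 : σ ≠ 0 ∨ t ≠ 0) (h1 : σ ≠ 1 ∨ t ≠ 0) :
    Real.log ‖W (σ + t * Complex.I)‖ = logNormW (t / 2) σ := by
  have hs : ∀ n : ℕ, (σ : ℂ) + t * Complex.I ≠ n + 1 := by
    intro n hn
    have hre := congrArg Complex.re hn
    have him := congrArg Complex.im hn
    simp at hre him
    have hn0 : (0 : ℝ) ≤ n := n.cast_nonneg
    exact h1.elim (fun h => h (by linarith)) (fun h => h him)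
  have hs' : ∀ n : ℕ, (σ : ℂ) + t * Complex.I ≠ -(2 * n) := by
    intro n hn
    refine add_natCast_ne_zero hσ h0 (2 * n) ?_
    push_cast
    linear_combination hn
  have hs'' : ∀ n : ℕ, 1 - ((σ : ℂ) + t * Complex.I) ≠ -(2 * n) := by
    intro n hn
    refine hs (2 * n) ?_
    push_cast
    linear_combination -hn
  have hden : Complex.Gammaℝ (σ + t * Complex.I) ≠ 0 := by
    rw [Ne, Complex.Gammaℝ_eq_zero_iff]
    exact fun ⟨n, hn⟩ => hs' n hn
  have hnum : Complex.Gammaℝ (1 - (σ + t * Complex.I)) ≠ 0 := by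
    rw [Ne, Complex.Gammaℝ_eq_zero_iff]
    exact fun ⟨n, hn⟩ => hs'' n hn
  rw [W_eq_Gammaℝ_div hs, norm_div, Real.log_div (norm_ne_zero_iff.2 hnum)
    (norm_ne_zero_iff.2 hden)]
  have e1 : 1 - ((σ : ℂ) + t * Complex.I) =
      ((1 - σ : ℝ) : ℂ) + 2 * (-(t / 2) : ℝ) * Complex.I := by
    push_cast
    ring
  have e2 : (σ : ℂ) + t * Complex.I = (σ : ℂ) + 2 * (t / 2 : ℝ) * Complex.I := by
    push_cast
    ring
  rw [e1, e2, log_norm_Gammaℝ (by linarith) (h1.imp (fun h => sub_ne_zero.2 h.symm)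
    fun h => neg_ne_zero.2 (by positivity)), log_norm_Gammaℝ hσ (h0.imp_right fun h => by positivity),
    norm_Gamma_neg_im, logNormW]
  ring

theorem mainTheorem6 (σ t : ℝ) (hσ0 : 0 ≤ σ) (hσ1 : σ ≤ 1) (hσ : σ ≠ 1 / 2)
    (hW : ‖W ((σ : ℂ) + (t : ℂ) * Complex.I)‖ = 1) :
    2 * Real.pi < |t| ∧ |t| < 2.01 * Real.pi := by
  -- W(0) = 0 because of the sine factor.
  have h0 : σ ≠ 0 ∨ t ≠ 0 := by
    by_contra! h
    simp [h.1, h.2, W] at hW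
  -- At the pole s = 1 the formula evaluates to 0, because `Complex.Gamma 0 = 0` by convention.
  have h1 : σ ≠ 1 ∨ t ≠ 0 := by
    by_contra! h
    simp [h.1, h.2, W] at hW
  have hz : logNormW (t / 2) σ = 0 := by rw [← log_norm_W hσ0 hσ1 h0 h1, hW, Real.log_one]
  obtain ⟨τ, hτ0, hτ, hτt, hzτ⟩ : ∃ τ : ℝ, 0 ≤ τ ∧ τ < 1 / 2 ∧ (τ ≠ 0 ∨ t / 2 ≠ 0) ∧
      logNormW (t / 2) τ = 0 := by
    rcases lt_or_gt_of_ne hσ with h | h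
    · exact ⟨σ, hσ0, h, h0.imp_right fun h => by positivity, hz⟩
    · refine ⟨1 - σ, by linarith, by linarith, h1.imp (fun h h' => h (by linarith))
        fun h => by positivity, ?_⟩
      rw [logNormW_one_sub, hz, neg_zero]
  have hpi := Real.pi_pos
  constructor
  · by_contra! h
    have hsq : (t / 2) ^ 2 ≤ Real.pi ^ 2 := sq_le_sq.2 (by
      rw [abs_div, abs_of_pos hpi, abs_two]
      linarith)
    linarith [logNormW_mono hsq hτ0 hτ.le hτt, logNormW_pi_neg hτ0 hτ]
  · by_contra! h
    have hsq : (1.005 * Real.pi) ^ 2 ≤ (t / 2) ^ 2 := sq_le_sq.2 (by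
      rw [abs_div, abs_of_pos (by positivity), abs_two]
      linarith)
    linarith [logNormW_mono hsq hτ0 hτ.le (Or.inr (by positivity)), logNormW_pos hτ0 hτ]
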